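/- **Corollary 2.2 (Riesz formula for polynomials).** Let $G$ be a closed subgroup of the orthogonal group $O(N)$, let $v\in\mathbb R^N$ be a unit vector, and let $M=Gv\subset\mathbb R^N$ be its orbit (a homogeneous manifold equivariantly embedded in $\mathbb R^N$), equipped with a finite $G$-invariant Borel measure. Let $\mathfrak g$ be the Lie algebra of $G$, i.e. the set of skew-symmetric $N\times N$ matrices $X$ with $\exp tX\in G$ for all $t\in\mathbb R$, and let $X_1,\dots,X_d$ be an orthonormal basis of $\mathfrak g$ with respect to $\langle X,Y\rangle=\tfrac12\operatorname{tr}(XY^{t})$. Put $e^{tD_j}f(x)=f(\exp tX_j\cdot x)$ and let $D_j$ be the infinitesimal generator, $D_jf=\lim_{t\to0}t^{-1}(e^{tD_j}f-f)$. Let $n\ge 1$ be an integer and let $\mathbf P_n(M)$ be the space of restrictions to $M$ of polynomials on $\mathbb R^N$ of degree at most $n$, with real or complex coefficients. Define $$\mathcal R_j^{n}f=\frac{n}{\pi^2}\sum_{k\in\mathbb Z}\frac{(-1)^{k-1}}{(k-1/2)^2}\,e^{t_kD_j}f,\qquad t_k=\frac{\pi}{n}\Big(k-\frac12\Big),\quad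 1\le j\le d .$$ Then for every $f\in\mathbf P_n(M)$ and all indices $1\le j_1,\dots,j_k\le d$, both sides below exist and $$D_{j_1}D_{j_2}\cdots D_{j_k}f=\mathcal R^n_{j_1}\mathcal R^n_{j_2}\cdots\mathcal R^n_{j_k}f .$$ In particular, for $\mathcal L=-(D_1^2+\cdots+D_d^2)$, $$\mathcal Lf=-\sum_{j=1}^d\mathcal R_j^n\mathcal R_j^n f .$$ Both formulas hold pointwise at every $x\in M$ (with limits and series taken pointwise) and in $L_p(M)$ for every $1\le p\le\infty$ (with limits and series taken in the $L_p$-norm), and the $L_p$ results are the classes of the pointwise ones. -/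

import Mathlib

open Filter Topology MeasureTheory
open scoped Matrix ENNReal

noncomputable section

namespace RieszFormula

/-! ### One-parameter groups of operators -/

section Abstract

variable {V : Type*} [AddCommGroup V] [Module ℝ V] [TopologicalSpace V]

/-- The graph of the infinitesimal generator `D` of a one-parameter family of operators `U`
(thought of as `U t = e^{tD}`): `GeneratorRel U f g` says that `f` is in the domain of `D` and
`D f = g`, i.e. that `(U t f - f) / t → g` as `t → 0`, `t ≠ 0`, in the topology of `V`. -/
def GeneratorRel (U : ℝ → V → V) (f g : V) : Prop :=
  Tendsto (fun t : ℝ => t⁻¹ • (U t f - f)) (𝓝[≠] 0) (𝓝 g)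

/-- The graph of the Riesz operator: `RieszRel ω U f g` says that the series
`(ω / π²) ∑_{k ∈ ℤ} (-1)^(k-1) / (k - 1/2)² U(t_k) f`, with `t_k = (π / ω) (k - 1/2)`,
converges (unconditionally) in the topology of `V` and that its sum is `g`. -/
def RieszRel (ω : ℝ) (U : ℝ → V → V) (f g : V) : Prop :=
  HasSum (fun k : ℤ =>
    (ω / Real.pi ^ 2 * ((-1 : ℝ) ^ (k - 1) / ((k : ℝ) - 1 / 2) ^ 2)) •
      U (Real.pi / ω * ((k : ℝ) - 1 / 2)) f) g

/-- The graph of the composition `A_{j₁} A_{j₂} ⋯ A_{j_k}` of the (single-valued, possibly only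
partially defined) operators with graphs `A j`, for the list `[j₁, …, j_k]`. The last operator
`A_{j_k}` is applied first. -/
def IterRel {ι W : Type*} (A : ι → W → W → Prop) : List ι → W → W → Prop
  | [], f, g => g = f
  | j :: J, f, g => ∃ h, IterRel A J f h ∧ A j h g

/-- The graph of the sum of squares `∑ j, A_j ∘ A_j` of the operators with graphs `A j`. -/
def SumSqRel {ι W : Type*} [Fintype ι] [AddCommGroup W] (A : ι → W → W → Prop) (f g : W) : Prop :=
  ∃ w : ι → W, (∀ j, IterRel A [j, j] f (w j)) ∧ g = ∑ j, w j

/-- The graph of the Laplace operator `𝓛 = -(D_1² + ⋯ + D_d²)`, where `D_j` is the infinitesimal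
generator of `U j`. -/
def LaplaceRel {d : ℕ} (U : Fin d → ℝ → V → V) (f g : V) : Prop :=
  SumSqRel (fun j => GeneratorRel (U j)) f (-g)

end Abstract

/-! ### Orbits of closed subgroups of the orthogonal group -/

variable {N : ℕ}

/-- The linear action of an `N × N` matrix on the Euclidean space `ℝ^N`. -/
def matAct (A : Matrix (Fin N) (Fin N) ℝ) (x : EuclideanSpace ℝ (Fin N)) :
    EuclideanSpace ℝ (Fin N) :=
  WithLp.toLp 2 (A *ᵥ x.ofLp)

theorem matAct_mul (A B : Matrix (Fin N) (Fin N) ℝ) (x : EuclideanSpace ℝ (Fin N)) :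
    matAct (A * B) x = matAct A (matAct B x) := by
  simp [matAct, Matrix.mulVec_mulVec]

/-- The equivariantly embedded homogeneous manifold: the orbit `M = G v ⊆ ℝ^N`. -/
def orbit (G : Subgroup (Matrix.orthogonalGroup (Fin N) ℝ)) (v : EuclideanSpace ℝ (Fin N)) :
    Set (EuclideanSpace ℝ (Fin N)) :=
  {x | ∃ g ∈ G, x = matAct (g : Matrix (Fin N) (Fin N) ℝ) v}

variable {G : Subgroup (Matrix.orthogonalGroup (Fin N) ℝ)} {v : EuclideanSpace ℝ (Fin N)}

/-- The action `x ↦ g · x` of `G` on the orbit `M`. -/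
def act (g : G) (x : orbit G v) : orbit G v :=
  ⟨matAct ((g : Matrix.orthogonalGroup (Fin N) ℝ) : Matrix (Fin N) (Fin N) ℝ) x, by
    obtain ⟨h, hh, hx⟩ := x.2
    exact ⟨g * h, G.mul_mem g.2 hh, by rw [hx, ← matAct_mul]; rfl⟩⟩

theorem continuous_act (g : G) : Continuous (act (v := v) g) := by
  unfold act matAct
  fun_prop

/-- The measure `μ` on the orbit is invariant under the action of `G`. -/
def InvariantMeasure (μ : Measure (orbit G v)) : Prop :=
  ∀ g : G, μ.map (act g) = μ

/-- The Lie algebra of `G`: skew-symmetric matrices `X` with `exp (t X) ∈ G` for all real `t`. -/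
def lieAlg (G : Subgroup (Matrix.orthogonalGroup (Fin N) ℝ)) :
    Set (Matrix (Fin N) (Fin N) ℝ) :=
  {X | Xᵀ = -X ∧ ∀ t : ℝ, ∃ g : G,
    ((g : Matrix.orthogonalGroup (Fin N) ℝ) : Matrix (Fin N) (Fin N) ℝ) = NormedSpace.exp (t • X)}

/-- The element `exp (t X)` of `G`, for `X` in the Lie algebra of `G`. It is determined by its
matrix, so the choice is no choice. -/
def expG (X : lieAlg G) (t : ℝ) : G := (X.2.2 t).choose

theorem coe_expG (X : lieAlg G) (t : ℝ) :
    ((expG X t : Matrix.orthogonalGroup (Fin N) ℝ) : Matrix (Fin N) (Fin N) ℝ) =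
      NormedSpace.exp (t • (X : Matrix (Fin N) (Fin N) ℝ)) :=
  (X.2.2 t).choose_spec

/-- `X_1, …, X_d` is an orthonormal basis of the Lie algebra of `G` for the scalar product
`⟨X, Y⟩ = (1/2) tr (X Yᵀ)`. -/
def IsOrthonormalBasis {d : ℕ} (X : Fin d → lieAlg G) : Prop :=
  (∀ i j, 1 / 2 * Matrix.trace ((X i : Matrix (Fin N) (Fin N) ℝ) *
      (X j : Matrix (Fin N) (Fin N) ℝ)ᵀ) = if i = j then 1 else 0) ∧
  ∀ Y ∈ lieAlg G, Y ∈ Submodule.span ℝ (Set.range fun j => (X j : Matrix (Fin N) (Fin N) ℝ))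

/-- `P_n(M)`: the restrictions to the orbit `M` of the polynomials on `ℝ^N` of degree at most `n`,
with coefficients in `𝕜`. -/
def polySpace (𝕜 : Type*) [RCLike 𝕜] (G : Subgroup (Matrix.orthogonalGroup (Fin N) ℝ))
    (v : EuclideanSpace ℝ (Fin N)) (n : ℕ) : Set (orbit G v → 𝕜) :=
  {f | ∃ P : MvPolynomial (Fin N) 𝕜, P.totalDegree ≤ n ∧
    ∀ x : orbit G v, f x = MvPolynomial.eval (fun i => ((x.1 i : ℝ) : 𝕜)) P}

section Translations

variable {𝕜 : Type*} [RCLike 𝕜]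

/-- Translation of functions on `M`, `(e^{tD_X} f)(x) = f (exp (t X) · x)`. The space of functions
on `M` carries the topology of pointwise convergence. -/
def translate (X : lieAlg G) (t : ℝ) (f : orbit G v → 𝕜) : orbit G v → 𝕜 :=
  fun x => f (act (expG X t) x)

theorem measurePreserving_act {μ : Measure (orbit G v)} (hμ : InvariantMeasure μ) (g : G) :
    MeasurePreserving (act g) μ μ :=
  ⟨(continuous_act g).measurable, hμ g⟩

/-- Translation on `L_p(M)`, `(e^{tD_X} f)(x) = f (exp (t X) · x)`. The space `L_p(M)` carries its
norm topology. -/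
def translateLp {μ : Measure (orbit G v)} (hμ : InvariantMeasure μ) (p : ℝ≥0∞) (X : lieAlg G)
    (t : ℝ) (f : Lp 𝕜 p μ) : Lp 𝕜 p μ :=
  Lp.compMeasurePreserving (act (expG X t)) (measurePreserving_act hμ (expG X t)) f

end Translations

end RieszFormula

end

noncomputable section

namespace RieszFormula


/-! Everything reduces to functions of one real variable. If `X` is skew with `tr (X Xᵀ) / 2 = 1`,
then `X` is a contraction (`dotProduct_mulVec_self_le`), so `exp (tX)` is built from plane rotations
of speed at most one, and the coordinates of `exp (tX) x` are combinations of `cos (ωt + φ)` with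
`|ω| ≤ 1`. Products add frequencies, so for `f` in `P_n(M)` the function `t ↦ f (exp (tX) x)` has
frequencies at most `n`. For one such harmonic the Riesz series gives the derivative at `0`; this is
the Fourier expansion of a triangular wave, obtained from the Bernoulli polynomial `B₂`.

Translations preserve the finite-dimensional, hence closed, space `P_n(M)`. So the generator maps it
to itself, agrees there with the Riesz operator, and both can be iterated. Any linear map from
`P_n(M)` to `L_p(M)` is continuous, which carries limits and sums over to the `L_p` norm. -/

/-! ### The Riesz formula for one harmonic -/

theorem hasSum_odd_cos {x : ℝ} (hx0 : 0 ≤ x) (hx1 : x ≤ 1 / 2) :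
    HasSum (fun n : ℕ => Real.cos (2 * Real.pi * (2 * n + 1) * x) / (2 * (n : ℝ) + 1) ^ 2)
      (Real.pi ^ 2 / 8 - Real.pi ^ 2 * x / 2) := by
  have key : ∀ y : ℝ, 0 ≤ y → y ≤ 1 →
      HasSum (fun n : ℕ => 1 / (n : ℝ) ^ 2 * Real.cos (2 * Real.pi * n * y))
        (Real.pi ^ 2 * (y ^ 2 - y + 6⁻¹)) := by
    intro y h0 h1
    have h := hasSum_one_div_nat_pow_mul_cos one_ne_zero (x := y) ⟨h0, h1⟩
    have hb := bernoulliFun_two y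
    rw [bernoulliFun] at hb
    rw [mul_one, hb] at h
    convert! h using 1
    rw [Nat.factorial_two]
    push_cast
    ring
  -- The even-indexed terms at `x` are a quarter of the full series at `2x`; `x ≤ 1/2` keeps `2x` in
  -- `[0, 1]`.
  have h1 := key x hx0 (by linarith)
  have h2 := (key (2 * x) (by linarith) (by linarith)).mul_left (1 / 4)
  have hodd : Summable (fun n : ℕ => 1 / ((2 * n + 1 : ℕ) : ℝ) ^ 2 *
      Real.cos (2 * Real.pi * (2 * n + 1 : ℕ) * x)) :=
    h1.summable.comp_injective (i := fun n : ℕ => 2 * n + 1)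
      (fun a b h => by simpa using h)
  have heven : HasSum (fun n : ℕ => 1 / ((2 * n : ℕ) : ℝ) ^ 2 *
      Real.cos (2 * Real.pi * (2 * n : ℕ) * x))
      (1 / 4 * (Real.pi ^ 2 * ((2 * x) ^ 2 - 2 * x + 6⁻¹))) := by
    convert! h2 using 2 with n
    push_cast
    rw [show 2 * Real.pi * (2 * (n : ℝ)) * x = 2 * Real.pi * n * (2 * x) by ring, mul_pow,
      one_div, mul_inv]
    ring
  obtain ⟨c, hc⟩ := hodd
  have hs := HasSum.unique (HasSum.even_add_odd
    (f := fun n : ℕ => 1 / (n : ℝ) ^ 2 * Real.cos (2 * Real.pi * n * x)) heven hc) h1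
  convert! hc using 1
  · ext n
    push_cast
    ring
  · linear_combination -hs

/-- With `A = nπ + π/2` and `sin A = (-1)^n`, half of `cos (A - θ) - cos (A + θ)` is `(-1)^n sin θ`.
The bound on `s` puts both arguments `(π ∓ s) / (4π)` in `[0, 1/2]`. -/
theorem hasSum_odd_sin {s : ℝ} (hs : |s| ≤ Real.pi) :
    HasSum (fun n : ℕ => (-1 : ℝ) ^ n / (2 * (n : ℝ) + 1) ^ 2 * Real.sin ((n + 1 / 2) * s))
      (Real.pi * s / 8) := by
  have hpi := Real.pi_pos
  obtain ⟨h1, h2⟩ := abs_le.mp hs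
  have a := hasSum_odd_cos (x := (Real.pi - s) / (4 * Real.pi)) (by apply div_nonneg <;> linarith)
    (by rw [div_le_iff₀ (by positivity)]; linarith)
  have b := hasSum_odd_cos (x := (Real.pi + s) / (4 * Real.pi)) (by apply div_nonneg <;> linarith)
    (by rw [div_le_iff₀ (by positivity)]; linarith)
  convert! (a.sub b).mul_left (1 / 2) using 1
  · ext n
    have e1 : 2 * Real.pi * (2 * n + 1) * ((Real.pi - s) / (4 * Real.pi)) =
        (n * Real.pi + Real.pi / 2) - (n + 1 / 2) * s := by
      field_simp
      ring
    have e2 : 2 * Real.pi * (2 * n + 1) * ((Real.pi + s) / (4 * Real.pi)) =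
        (n * Real.pi + Real.pi / 2) + (n + 1 / 2) * s := by
      field_simp
      ring
    have e3 : Real.sin (n * Real.pi + Real.pi / 2) = (-1) ^ n := by
      rw [Real.sin_add_pi_div_two, Real.cos_nat_mul_pi]
    rw [e1, e2, Real.cos_sub (n * Real.pi + Real.pi / 2), Real.cos_add (n * Real.pi + Real.pi / 2),
      e3]
    ring
  · field_simp
    ring

/-- The Riesz interpolation formula for a single harmonic of frequency at most `r`. -/
theorem hasSum_riesz_cos {r ω : ℝ} (hr : 0 < r) (hω : |ω| ≤ r) (φ : ℝ) :
    HasSum (fun k : ℤ => (r / Real.pi ^ 2 * ((-1 : ℝ) ^ (k - 1) / ((k : ℝ) - 1 / 2) ^ 2)) *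
      Real.cos (ω * (Real.pi / r * ((k : ℝ) - 1 / 2)) + φ)) (-ω * Real.sin φ) := by
  have hpi := Real.pi_pos
  set s : ℝ := ω * Real.pi / r with hs_def
  have hs : |s| ≤ Real.pi := by
    rw [hs_def, abs_div, abs_mul, abs_of_pos hr, abs_of_pos hpi, div_le_iff₀ hr, mul_comm]
    gcongr
  have hS := hasSum_odd_sin hs
  -- Only convergence of the cosine part matters: its sum cancels between positive and negative
  -- nodes.
  have hC : Summable (fun n : ℕ => (-1 : ℝ) ^ n / (2 * (n : ℝ) + 1) ^ 2 *
      Real.cos ((n + 1 / 2) * s)) := by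
    have h0 := (hasSum_odd_cos (x := 0) le_rfl (by norm_num)).summable
    refine Summable.of_norm_bounded h0 fun n => ?_
    rw [mul_zero, Real.cos_zero, norm_mul, norm_div, norm_pow, norm_neg, norm_one, one_pow,
      Real.norm_of_nonneg (by positivity : 0 ≤ (2 * (n : ℝ) + 1) ^ 2)]
    exact mul_le_of_le_one_right (by positivity) (Real.abs_cos_le_one _)
  have hp := ((hC.hasSum.mul_right (Real.cos φ)).sub (hS.mul_right (Real.sin φ))).mul_left
    (4 * (r / Real.pi ^ 2))
  have hm := ((hC.hasSum.mul_right (Real.cos φ)).add (hS.mul_right (Real.sin φ))).mul_left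
    (-4 * (r / Real.pi ^ 2))
  -- After this shift the two halves of `ℤ` are `k = n + 1` and `k = -n`, with nodes `±(n + 1/2)`
  -- and opposite signs.
  rw [← (Equiv.addRight (1 : ℤ)).hasSum_iff]
  convert! HasSum.of_nat_of_neg_add_one (f := (fun k : ℤ => (r / Real.pi ^ 2 *
      ((-1 : ℝ) ^ (k - 1) / ((k : ℝ) - 1 / 2) ^ 2)) *
      Real.cos (ω * (Real.pi / r * ((k : ℝ) - 1 / 2)) + φ)) ∘ (Equiv.addRight (1 : ℤ)))
    (m := _) (m' := _) ?_ ?_ using 1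
  rotate_left 3
  · convert! hp using 2 with n
    simp only [Function.comp, Equiv.coe_addRight, add_sub_cancel_right, zpow_natCast]
    have e : ω * (Real.pi / r * (((n : ℤ) + 1 : ℤ) - 1 / 2)) + φ = (n + 1 / 2) * s + φ := by
      push_cast
      rw [hs_def]
      ring
    rw [e, Real.cos_add]
    push_cast
    have : (2 * (n : ℝ) + 1) ≠ 0 := by positivity
    have h2 : (n : ℝ) + 1 - 1 / 2 = (2 * n + 1) / 2 := by ring
    rw [h2]
    field_simp
    ring
  · convert! hm using 2 with n
    simp only [Function.comp, Equiv.coe_addRight, add_sub_cancel_right]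
    have e : ω * (Real.pi / r * ((-((n : ℤ) + 1) + 1 : ℤ) - 1 / 2)) + φ = φ - (n + 1 / 2) * s := by
      push_cast
      rw [hs_def]
      ring
    have e2 : (-1 : ℝ) ^ (-((n : ℤ) + 1)) = -(-1) ^ n := by
      rw [zpow_neg, ← inv_zpow, inv_neg, inv_one, zpow_add₀ (by norm_num)]
      simp
    rw [e, e2, Real.cos_sub]
    push_cast
    have : (2 * (n : ℝ) + 1) ≠ 0 := by positivity
    have h2 : -((n : ℝ) + 1) + 1 - 1 / 2 = -((2 * n + 1) / 2) := by ring
    rw [h2]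
    field_simp
    ring
  · rw [hs_def]
    field_simp
    ring


/-! ### Flows of skew-symmetric matrices of norm one -/

variable {N : ℕ}

/-- A skew-symmetric matrix of norm one for `⟨X, Y⟩ = tr (X Yᵀ) / 2` is a contraction. -/
theorem dotProduct_mulVec_self_le {X : Matrix (Fin N) (Fin N) ℝ} (hX : Xᵀ = -X)
    (hn : 1 / 2 * Matrix.trace (X * Xᵀ) = 1) (u : Fin N → ℝ) :
    (X *ᵥ u) ⬝ᵥ (X *ᵥ u) ≤ u ⬝ᵥ u := by
  set w := X *ᵥ u with hw
  have hskew : ∀ a b : Fin N → ℝ, a ⬝ᵥ (X *ᵥ b) = -((X *ᵥ a) ⬝ᵥ b) := fun a b => by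
    rw [Matrix.dotProduct_mulVec, ← Matrix.mulVec_transpose, hX, Matrix.neg_mulVec,
      neg_dotProduct]
  have huw : u ⬝ᵥ w = 0 := by
    have := hskew u u
    rw [← hw, dotProduct_comm w u] at this
    linarith
  have huu : 0 ≤ u ⬝ᵥ u := Finset.sum_nonneg fun i _ => mul_self_nonneg _
  have hXX : ∑ i, ∑ j, X i j * X i j = 2 := by
    simp only [Matrix.trace, Matrix.diag, Matrix.mul_apply, Matrix.transpose_apply] at hn
    linarith
  have h1 : ∑ i, ∑ j, X i j * (w i * u j) = w ⬝ᵥ w := by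
    conv_rhs => rw [dotProduct]
    refine Finset.sum_congr rfl fun i _ => ?_
    conv_rhs => rw [hw, Matrix.mulVec, dotProduct, Finset.sum_mul]
    refine Finset.sum_congr rfl fun j _ => ?_
    rw [hw, Matrix.mulVec, dotProduct]
    ring
  have h2 : ∑ i, ∑ j, X i j * (u i * w j) = -(w ⬝ᵥ w) := by
    rw [hw, ← hskew, ← hw, dotProduct]
    refine Finset.sum_congr rfl fun i _ => ?_
    rw [Matrix.mulVec, dotProduct, Finset.mul_sum]
    exact Finset.sum_congr rfl fun j _ => by ring
  have h3 : ∀ a b c d : Fin N → ℝ,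
      ∑ i, ∑ j, (a i * b j) * (c i * d j) = (a ⬝ᵥ c) * (b ⬝ᵥ d) := fun a b c d => by
    simp only [dotProduct, Finset.sum_mul_sum]
    exact Finset.sum_congr rfl fun i _ => Finset.sum_congr rfl fun j _ => by ring
  -- With `w = Xu ⊥ u`, the squared Frobenius norm of `|u|² X - (w uᵀ - u wᵀ)` is `2|u|² (|u|² -
  -- |w|²)`, and it is nonnegative.
  have key : ∀ c : ℝ, ∑ i, ∑ j, (c * X i j - (w i * u j - u i * w j)) ^ 2 =
      c ^ 2 * (∑ i, ∑ j, X i j * X i j) - 2 * c * (∑ i, ∑ j, X i j * (w i * u j)) +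
        2 * c * (∑ i, ∑ j, X i j * (u i * w j)) + (∑ i, ∑ j, (w i * u j) * (w i * u j)) +
        (∑ i, ∑ j, (u i * w j) * (u i * w j)) - 2 * (∑ i, ∑ j, (w i * u j) * (u i * w j)) := by
    intro c
    simp only [Finset.mul_sum, ← Finset.sum_add_distrib, ← Finset.sum_sub_distrib]
    exact Finset.sum_congr rfl fun i _ => Finset.sum_congr rfl fun j _ => by ring
  replace key := key (u ⬝ᵥ u)
  rw [hXX, h1, h2, h3, h3, h3, huw] at key
  have hpos : 0 ≤ ∑ i, ∑ j, ((u ⬝ᵥ u) * X i j - (w i * u j - u i * w j)) ^ 2 :=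
    Finset.sum_nonneg fun i _ => Finset.sum_nonneg fun j _ => sq_nonneg _
  rcases huu.eq_or_lt with h0 | h0
  · have hu : u = 0 := dotProduct_self_eq_zero.mp h0.symm
    simp [hw, hu]
  · by_contra! hlt
    nlinarith [mul_pos h0 (sub_pos.mpr hlt)]

section

open scoped Matrix.Norms.Operator

theorem hasDerivAt_exp_smul_mulVec (X : Matrix (Fin N) (Fin N) ℝ) (u : Fin N → ℝ) (t : ℝ) :
    HasDerivAt (fun s : ℝ => NormedSpace.exp (s • X) *ᵥ u)
      (NormedSpace.exp (t • X) *ᵥ (X *ᵥ u)) t := by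
  let L : Matrix (Fin N) (Fin N) ℝ →ₗ[ℝ] (Fin N → ℝ) :=
    { toFun := fun A => A *ᵥ u
      map_add' := fun A B => Matrix.add_mulVec A B u
      map_smul' := fun c A => Matrix.smul_mulVec c A u }
  have h := (LinearMap.toContinuousLinearMap L).hasFDerivAt.comp_hasDerivAt t
    (hasDerivAt_exp_smul_const X t)
  rw [Matrix.mulVec_mulVec]
  exact h

end

theorem exp_smul_mulVec_of_rotation {X : Matrix (Fin N) (Fin N) ℝ} {u w : Fin N → ℝ} {a : ℝ}
    (hu : X *ᵥ u = a • w) (hw : X *ᵥ w = -a • u) (t : ℝ) :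
    NormedSpace.exp (t • X) *ᵥ u = Real.cos (a * t) • u + Real.sin (a * t) • w := by
  -- Undoing the flow on the claimed solution gives a curve with zero derivative.
  set F : ℝ → Fin N → ℝ := fun s => Real.cos (a * s) • (NormedSpace.exp (s • -X) *ᵥ u) +
    Real.sin (a * s) • (NormedSpace.exp (s • -X) *ᵥ w) with hF
  have hd : ∀ s, HasDerivAt F 0 s := fun s => by
    have hl : HasDerivAt (fun s : ℝ => a * s) a s := by
      simpa using (hasDerivAt_id s).const_mul a
    have h := (hl.cos.smul (hasDerivAt_exp_smul_mulVec (-X) u s)).add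
      (hl.sin.smul (hasDerivAt_exp_smul_mulVec (-X) w s))
    convert! h using 1
    rw [Matrix.neg_mulVec, Matrix.neg_mulVec, hu, hw, Matrix.mulVec_neg, Matrix.mulVec_neg,
      Matrix.mulVec_smul, Matrix.mulVec_smul]
    module
  have hc : F t = F 0 := is_const_of_deriv_eq_zero (fun s => (hd s).differentiableAt)
    (fun s => (hd s).deriv) t 0
  have hF0 : F 0 = u := by simp [hF]
  have hFt : F t = NormedSpace.exp (t • -X) *ᵥ
      (Real.cos (a * t) • u + Real.sin (a * t) • w) := by
    rw [Matrix.mulVec_add, Matrix.mulVec_smul, Matrix.mulVec_smul]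
  have hinv : NormedSpace.exp (t • X) * NormedSpace.exp (t • -X) = 1 := by
    rw [← Matrix.exp_add_of_commute _ _ (by
      rw [smul_neg]; exact (Commute.refl _).neg_right), smul_neg, add_neg_cancel,
      NormedSpace.exp_zero]
  rw [← hF0, ← hc, hFt, Matrix.mulVec_mulVec, hinv, Matrix.one_mulVec, ← hFt, hc, hF0]

/-- Under the flow of a skew-symmetric matrix that is a contraction, every vector is a
superposition of rotations of speed at most one. -/
theorem exists_exp_smul_mulVec_eq {X : Matrix (Fin N) (Fin N) ℝ} (hX : Xᵀ = -X)
    (hn : 1 / 2 * Matrix.trace (X * Xᵀ) = 1) (x : Fin N → ℝ) :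
    ∃ (a : Fin N → ℝ) (u w : Fin N → Fin N → ℝ), (∀ j, |a j| ≤ 1) ∧ ∀ t : ℝ,
      NormedSpace.exp (t • X) *ᵥ x =
        ∑ j, (Real.cos (a j * t) • u j + Real.sin (a j * t) • w j) := by
  -- Since `XᵀX = -X²`, a unit eigenvector `e` with eigenvalue `a² = |Xe|²` is rotated at speed `a`
  -- in the plane of `e` and `a⁻¹ X e`.
  have hA : (Xᵀ * X).IsHermitian := by
    simpa using Matrix.isHermitian_conjTranspose_mul_self X
  set e : Fin N → Fin N → ℝ := fun j => (hA.eigenvectorBasis j).ofLp with he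
  have hdot : ∀ j, e j ⬝ᵥ e j = 1 := fun j => by
    have h := hA.eigenvectorBasis.orthonormal.1 j
    have h2 : inner ℝ (hA.eigenvectorBasis j) (hA.eigenvectorBasis j) = 1 := by
      rw [real_inner_self_eq_norm_sq, h, one_pow]
    rw [EuclideanSpace.inner_eq_star_dotProduct] at h2
    simpa using h2
  have hsq : ∀ y : Fin N → ℝ, X *ᵥ (X *ᵥ y) = -((Xᵀ * X) *ᵥ y) := fun y => by
    rw [hX, neg_mul, Matrix.neg_mulVec, neg_neg, Matrix.mulVec_mulVec]
  have hsq' : ∀ y : Fin N → ℝ, (X *ᵥ y) ⬝ᵥ (X *ᵥ y) = -((X *ᵥ (X *ᵥ y)) ⬝ᵥ y) := fun y => by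
    rw [Matrix.dotProduct_mulVec, ← Matrix.mulVec_transpose, hX, Matrix.neg_mulVec, neg_dotProduct]
  have heig : ∀ j, X *ᵥ (X *ᵥ e j) = -(hA.eigenvalues j) • e j := fun j => by
    have h := hA.mulVec_eigenvectorBasis j
    rw [hsq, neg_smul]
    exact congrArg _ h
  have hval : ∀ j, (X *ᵥ e j) ⬝ᵥ (X *ᵥ e j) = hA.eigenvalues j := fun j => by
    rw [hsq', heig, smul_dotProduct, hdot, smul_eq_mul, mul_one, neg_neg]
  have h0 : ∀ j, 0 ≤ hA.eigenvalues j := fun j => by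
    rw [← hval]
    exact Finset.sum_nonneg fun i _ => mul_self_nonneg _
  have h1 : ∀ j, hA.eigenvalues j ≤ 1 := fun j => by
    rw [← hval, ← hdot j]
    exact dotProduct_mulVec_self_le hX hn _
  set a : Fin N → ℝ := fun j => Real.sqrt (hA.eigenvalues j) with ha
  have haa : ∀ j, a j * a j = hA.eigenvalues j := fun j => Real.mul_self_sqrt (h0 j)
  -- For `a j = 0` the convention `0⁻¹ = 0` is harmless, as then `X e = 0`.
  have hu : ∀ j, X *ᵥ e j = a j • ((a j)⁻¹ • (X *ᵥ e j)) := fun j => by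
    by_cases hj : a j = 0
    · have h : (X *ᵥ e j) ⬝ᵥ (X *ᵥ e j) = 0 := by rw [hval, ← haa, hj, mul_zero]
      rw [dotProduct_self_eq_zero.mp h, smul_zero, smul_zero]
    · rw [smul_inv_smul₀ hj]
  have hw : ∀ j, X *ᵥ ((a j)⁻¹ • (X *ᵥ e j)) = -a j • e j := fun j => by
    rw [Matrix.mulVec_smul, heig, ← haa, smul_smul]
    by_cases hj : a j = 0
    · simp [hj]
    · congr 1
      field_simp
  refine ⟨a, fun j => hA.eigenvectorBasis.repr (WithLp.toLp 2 x) j • e j,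
    fun j => hA.eigenvectorBasis.repr (WithLp.toLp 2 x) j • ((a j)⁻¹ • (X *ᵥ e j)), fun j => ?_,
    fun t => ?_⟩
  · rw [abs_of_nonneg (Real.sqrt_nonneg _)]
    exact Real.sqrt_le_one.mpr (h1 j)
  · have hx : x = ∑ j, hA.eigenvectorBasis.repr (WithLp.toLp 2 x) j • e j := by
      have h := congrArg WithLp.ofLp (hA.eigenvectorBasis.sum_repr (WithLp.toLp 2 x))
      rw [WithLp.ofLp_sum] at h
      exact h.symm
    conv_lhs => rw [hx, Matrix.mulVec_sum]
    refine Finset.sum_congr rfl fun j _ => ?_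
    rw [Matrix.mulVec_smul, exp_smul_mulVec_of_rotation (hu j) (hw j), smul_add,
      smul_comm (Real.cos _), smul_comm (Real.sin _) (hA.eigenvectorBasis.repr _ j)]

/-! ### Trigonometric sums -/

section TrigSum

variable {𝕜 : Type*} [RCLike 𝕜]

/-- The `𝕜`-linear combinations of the functions `t ↦ cos (ω t + φ)` with `|ω| ≤ r`. -/
def trigSum (𝕜 : Type*) [RCLike 𝕜] (r : ℝ) : Submodule 𝕜 (ℝ → 𝕜) :=
  Submodule.span 𝕜 {h | ∃ ω φ : ℝ, |ω| ≤ r ∧ h = fun t => ((Real.cos (ω * t + φ) : ℝ) : 𝕜)}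

theorem cos_mem_trigSum {r ω : ℝ} (h : |ω| ≤ r) (φ : ℝ) :
    (fun t : ℝ => ((Real.cos (ω * t + φ) : ℝ) : 𝕜)) ∈ trigSum 𝕜 r :=
  Submodule.subset_span ⟨ω, φ, h, rfl⟩

theorem trigSum_mono {r s : ℝ} (h : r ≤ s) : trigSum 𝕜 r ≤ trigSum 𝕜 s :=
  Submodule.span_mono fun _ ⟨ω, φ, hω, e⟩ => ⟨ω, φ, hω.trans h, e⟩

/-- The product-to-sum formula turns frequencies `ω`, `ω'` into `ω ± ω'`. -/
theorem mul_mem_trigSum {r s : ℝ} {f g : ℝ → 𝕜} (hf : f ∈ trigSum 𝕜 r) (hg : g ∈ trigSum 𝕜 s) :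
    f * g ∈ trigSum 𝕜 (r + s) := by
  have h := Submodule.mul_mem_mul hf hg
  rw [trigSum, trigSum, Submodule.span_mul_span] at h
  refine Submodule.span_le.mpr ?_ h
  rintro _ ⟨_, ⟨ω, φ, hω, rfl⟩, _, ⟨ω', φ', hω', rfl⟩, rfl⟩
  have e : ((fun t : ℝ => ((Real.cos (ω * t + φ) : ℝ) : 𝕜)) *
      fun t : ℝ => ((Real.cos (ω' * t + φ') : ℝ) : 𝕜)) =
      (2⁻¹ : 𝕜) • ((fun t : ℝ => ((Real.cos ((ω - ω') * t + (φ - φ')) : ℝ) : 𝕜)) +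
        fun t : ℝ => ((Real.cos ((ω + ω') * t + (φ + φ')) : ℝ) : 𝕜)) := by
    ext t
    have h1 : (ω - ω') * t + (φ - φ') = (ω * t + φ) - (ω' * t + φ') := by ring
    have h2 : (ω + ω') * t + (φ + φ') = (ω * t + φ) + (ω' * t + φ') := by ring
    simp only [Pi.mul_apply, Pi.smul_apply, Pi.add_apply, h1, h2, Real.cos_sub (ω * t + φ),
      Real.cos_add (ω * t + φ), smul_eq_mul]
    push_cast
    ring
  change _ * _ ∈ trigSum 𝕜 (r + s)
  rw [e]
  refine Submodule.smul_mem _ _ (Submodule.add_mem _ (cos_mem_trigSum ?_ _)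
    (cos_mem_trigSum ?_ _))
  · exact (abs_sub _ _).trans (add_le_add hω hω')
  · exact (abs_add_le _ _).trans (add_le_add hω hω')

theorem const_mem_trigSum (c : 𝕜) {r : ℝ} (hr : 0 ≤ r) : (fun _ => c) ∈ trigSum 𝕜 r := by
  have h := Submodule.smul_mem _ c (cos_mem_trigSum (𝕜 := 𝕜) (r := r) (ω := 0) (by simpa) 0)
  convert! h using 1
  ext t
  simp

/-- The derivative at the origin of a trigonometric sum exists and is given by the Riesz
interpolation formula. -/
theorem exists_riesz_of_mem_trigSum {r : ℝ} (hr : 0 < r) {h : ℝ → 𝕜} (hh : h ∈ trigSum 𝕜 r) :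
    ∃ c : 𝕜, HasDerivAt h c 0 ∧
      HasSum (fun k : ℤ => (r / Real.pi ^ 2 * ((-1 : ℝ) ^ (k - 1) / ((k : ℝ) - 1 / 2) ^ 2)) •
        h (Real.pi / r * ((k : ℝ) - 1 / 2))) c := by
  induction hh using Submodule.span_induction with
  | mem h hmem =>
    obtain ⟨ω, φ, hω, rfl⟩ := hmem
    refine ⟨((-ω * Real.sin φ : ℝ) : 𝕜), ?_, ?_⟩
    · have hl : HasDerivAt (fun t : ℝ => ω * t + φ) ω 0 := by
        simpa using ((hasDerivAt_id (0 : ℝ)).const_mul ω).add_const φ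
      have h1 := (RCLike.ofRealCLM (K := 𝕜)).hasFDerivAt.comp_hasDerivAt 0 hl.cos
      convert! h1 using 1
      simp [mul_comm]
    · have h1 := (RCLike.ofRealCLM (K := 𝕜)).hasSum (hasSum_riesz_cos hr hω φ)
      convert! h1 using 2 with k
      simp [RCLike.real_smul_eq_coe_mul]
  | zero => exact ⟨0, hasDerivAt_const _ _, by simp⟩
  | add f g _ _ hf hg =>
    obtain ⟨c, h1, h2⟩ := hf
    obtain ⟨d, h3, h4⟩ := hg
    refine ⟨c + d, h1.add h3, ?_⟩
    simpa only [Pi.add_apply, smul_add] using h2.add h4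
  | smul a f _ hf =>
    obtain ⟨c, h1, h2⟩ := hf
    refine ⟨a • c, h1.const_smul a, ?_⟩
    simpa only [Pi.smul_apply, smul_comm _ a] using h2.const_smul a

end TrigSum


/-! ### Polynomials on the orbit -/

/-- Substitution into a polynomial of degree at most `n` respects a filtration. -/
theorem eval₂_mem_of_totalDegree_le {R A σ : Type*} [CommSemiring R] [CommSemiring A] [Fintype σ]
    {φ : R →+* A} {y : σ → A} {S : ℕ → AddSubmonoid A} (hmono : Monotone S)
    (hφ : ∀ c, φ c ∈ S 0) (hmul : ∀ {i j a b}, a ∈ S i → b ∈ S j → a * b ∈ S (i + j))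
    (hy : ∀ i, y i ∈ S 1) {n : ℕ} {P : MvPolynomial σ R} (hP : P.totalDegree ≤ n) :
    P.eval₂ φ y ∈ S n := by
  have h1 : (1 : A) ∈ S 0 := by simpa using hφ 1
  have hpow : ∀ i k, y i ^ k ∈ S k := fun i k => by
    induction k with
    | zero => simpa using h1
    | succ k ih =>
      rw [pow_succ]
      exact hmul ih (hy i)
  have hprod : ∀ (d : σ → ℕ) (s : Finset σ), ∏ i ∈ s, y i ^ d i ∈ S (∑ i ∈ s, d i) := by
    classical
    intro d s
    induction s using Finset.induction_on with
    | empty => simpa using h1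
    | insert i s hi ih =>
      rw [Finset.prod_insert hi, Finset.sum_insert hi]
      exact hmul (hpow _ _) ih
  rw [MvPolynomial.eval₂_eq']
  refine AddSubmonoid.sum_mem _ fun d hd => ?_
  have h := hmul (hφ (P.coeff d)) (hprod d Finset.univ)
  refine hmono ?_ h
  have hle := (MvPolynomial.le_totalDegree hd).trans hP
  rw [Finsupp.sum_fintype _ _ fun _ => rfl] at hle
  rwa [zero_add]

/-- Reads a family of polynomial values as one polynomial in functions, so that the filtration lemma
applies to function algebras. -/
theorem eval₂_pi_apply {R σ α : Type*} [CommSemiring R] (y : σ → α → R) (P : MvPolynomial σ R)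
    (a : α) : P.eval₂ (Pi.constRingHom α R) y a = P.eval (fun i => y i a) := by
  have h := MvPolynomial.eval₂_comp_left (Pi.evalRingHom (fun _ : α => R) a)
    (Pi.constRingHom α R) y P
  exact h

variable {G : Subgroup (Matrix.orthogonalGroup (Fin N) ℝ)}
  {v : EuclideanSpace ℝ (Fin N)} {𝕜 : Type*} [RCLike 𝕜]

/-- The coordinate functions on the orbit. -/
def coordFun (𝕜 : Type*) [RCLike 𝕜] (G : Subgroup (Matrix.orthogonalGroup (Fin N) ℝ))
    (v : EuclideanSpace ℝ (Fin N)) (i : Fin N) : orbit G v → 𝕜 := fun x => ((x.1 i : ℝ) : 𝕜)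

/-- `P_n(M)` as a linear subspace of the functions on the orbit. -/
def polySubmodule (𝕜 : Type*) [RCLike 𝕜] (G : Subgroup (Matrix.orthogonalGroup (Fin N) ℝ))
    (v : EuclideanSpace ℝ (Fin N)) (n : ℕ) : Submodule 𝕜 (orbit G v → 𝕜) :=
  (MvPolynomial.restrictTotalDegree (Fin N) 𝕜 n).map
    (MvPolynomial.aeval (coordFun 𝕜 G v)).toLinearMap

instance (n : ℕ) : FiniteDimensional 𝕜 (polySubmodule 𝕜 G v n) :=
  Module.Finite.map _ _

theorem aeval_coordFun_apply (P : MvPolynomial (Fin N) 𝕜) (x : orbit G v) :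
    MvPolynomial.aeval (coordFun 𝕜 G v) P x = P.eval (fun i => ((x.1 i : ℝ) : 𝕜)) :=
  eval₂_pi_apply (coordFun 𝕜 G v) P x

theorem mem_polySubmodule {n : ℕ} {f : orbit G v → 𝕜} :
    f ∈ polySubmodule 𝕜 G v n ↔ f ∈ polySpace 𝕜 G v n := by
  simp only [polySubmodule, Submodule.mem_map, MvPolynomial.mem_restrictTotalDegree, polySpace,
    Set.mem_ofPred_eq, AlgHom.toLinearMap_apply]
  refine exists_congr fun P => and_congr_right fun _ => ?_
  rw [funext_iff]
  simp only [aeval_coordFun_apply, eq_comm]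

/-- The group acts linearly, so the translated coordinates have degree at most one and substituting
them does not raise the degree. -/
theorem translate_mem {n : ℕ} (X : lieAlg G) (t : ℝ) {f : orbit G v → 𝕜}
    (hf : f ∈ polySubmodule 𝕜 G v n) : translate X t f ∈ polySubmodule 𝕜 G v n := by
  obtain ⟨P, hP, rfl⟩ := hf
  have hP' := (MvPolynomial.mem_restrictTotalDegree _ _ _).mp hP
  have e : translate X t (MvPolynomial.aeval (coordFun 𝕜 G v) P) =
      P.eval₂ (Pi.constRingHom (orbit G v) 𝕜)
        (fun i x => (((act (expG X t) x).1 i : ℝ) : 𝕜)) := by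
    ext x
    rw [eval₂_pi_apply, translate, aeval_coordFun_apply]
  change translate X t (MvPolynomial.aeval (coordFun 𝕜 G v) P) ∈ _
  rw [e]
  refine eval₂_mem_of_totalDegree_le (S := fun k => (polySubmodule 𝕜 G v k).toAddSubmonoid)
    (fun i j h => Submodule.map_mono ?_) (fun c => ?_) ?_ (fun i => ?_) hP'
  · exact fun p hp => (MvPolynomial.mem_restrictTotalDegree _ _ _).mpr
      (((MvPolynomial.mem_restrictTotalDegree _ _ _).mp hp).trans h)
  · exact ⟨MvPolynomial.C c, (MvPolynomial.mem_restrictTotalDegree _ _ _).mpr (by simp),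
      MvPolynomial.aeval_C _ c⟩
  · rintro i j _ _ ⟨p, hp, rfl⟩ ⟨q, hq, rfl⟩
    exact ⟨p * q, (MvPolynomial.mem_restrictTotalDegree _ _ _).mpr
      ((MvPolynomial.totalDegree_mul _ _).trans (add_le_add
        ((MvPolynomial.mem_restrictTotalDegree _ _ _).mp hp)
        ((MvPolynomial.mem_restrictTotalDegree _ _ _).mp hq))), map_mul (MvPolynomial.aeval (coordFun 𝕜 G v)) _ _⟩
  · set g := ((expG X t : Matrix.orthogonalGroup (Fin N) ℝ) : Matrix (Fin N) (Fin N) ℝ) with hg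
    have e2 : (fun x : orbit G v => (((act (expG X t) x).1 i : ℝ) : 𝕜)) =
        ∑ j, (g i j : 𝕜) • coordFun 𝕜 G v j := by
      ext x
      simp [act, matAct, coordFun, Matrix.mulVec, dotProduct, hg]
    change (fun x : orbit G v => (((act (expG X t) x).1 i : ℝ) : 𝕜)) ∈ polySubmodule 𝕜 G v 1
    rw [e2]
    refine Submodule.sum_mem _ fun j _ => Submodule.smul_mem _ _ ⟨MvPolynomial.X j,
      (MvPolynomial.mem_restrictTotalDegree _ _ _).mpr (by simp), MvPolynomial.aeval_X _ j⟩

theorem coord_expG_mem_trigSum {X : lieAlg G}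
    (hX : 1 / 2 * Matrix.trace ((X : Matrix (Fin N) (Fin N) ℝ) *
      (X : Matrix (Fin N) (Fin N) ℝ)ᵀ) = 1) (x : orbit G v) (i : Fin N) :
    (fun t : ℝ => (((act (expG X t) x).1 i : ℝ) : 𝕜)) ∈ trigSum 𝕜 1 := by
  obtain ⟨a, u, w, ha, h⟩ := exists_exp_smul_mulVec_eq X.2.1 hX x.1.ofLp
  -- The sines are cosines with phase `-π/2`.
  have e : (fun t : ℝ => (((act (expG X t) x).1 i : ℝ) : 𝕜)) =
      ∑ j, ((u j i : 𝕜) • (fun t : ℝ => ((Real.cos (a j * t + 0) : ℝ) : 𝕜)) +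
        (w j i : 𝕜) • (fun t : ℝ => ((Real.cos (a j * t + -(Real.pi / 2)) : ℝ) : 𝕜))) := by
    ext t
    have h1 : (act (expG X t) x).1 i =
        ∑ j, (Real.cos (a j * t) * u j i + Real.sin (a j * t) * w j i) := by
      have h2 := congrFun (h t) i
      rw [← coe_expG] at h2
      simpa [act, matAct] using h2
    rw [h1, Finset.sum_apply, RCLike.ofReal_sum]
    refine Finset.sum_congr rfl fun j _ => ?_
    simp only [Pi.add_apply, Pi.smul_apply, smul_eq_mul, add_zero, ← sub_eq_add_neg,
      Real.cos_sub_pi_div_two]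
    push_cast
    ring
  rw [e]
  exact Submodule.sum_mem _ fun j _ => Submodule.add_mem _
    (Submodule.smul_mem _ _ (cos_mem_trigSum (ha j) _))
    (Submodule.smul_mem _ _ (cos_mem_trigSum (ha j) _))

theorem translate_apply_mem_trigSum {n : ℕ} {X : lieAlg G}
    (hX : 1 / 2 * Matrix.trace ((X : Matrix (Fin N) (Fin N) ℝ) *
      (X : Matrix (Fin N) (Fin N) ℝ)ᵀ) = 1) {f : orbit G v → 𝕜}
    (hf : f ∈ polySubmodule 𝕜 G v n) (x : orbit G v) :
    (fun t => translate X t f x) ∈ trigSum 𝕜 n := by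
  obtain ⟨P, hP, rfl⟩ := hf
  have hP' := (MvPolynomial.mem_restrictTotalDegree _ _ _).mp hP
  have e : (fun t => translate X t (MvPolynomial.aeval (coordFun 𝕜 G v) P) x) =
      P.eval₂ (Pi.constRingHom ℝ 𝕜) (fun i t => (((act (expG X t) x).1 i : ℝ) : 𝕜)) := by
    ext t
    rw [eval₂_pi_apply, translate, aeval_coordFun_apply]
  change (fun t => translate X t (MvPolynomial.aeval (coordFun 𝕜 G v) P) x) ∈ _
  rw [e]
  refine eval₂_mem_of_totalDegree_le (S := fun k => (trigSum 𝕜 k).toAddSubmonoid)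
    (fun i j h => trigSum_mono (Nat.cast_le.mpr h)) (fun c => const_mem_trigSum c (by simp))
    (fun {i j a b} ha hb => ?_) (fun i => ?_) hP'
  · change a * b ∈ trigSum 𝕜 ((i + j : ℕ) : ℝ)
    rw [Nat.cast_add]
    exact mul_mem_trigSum ha hb
  · change _ ∈ trigSum 𝕜 ((1 : ℕ) : ℝ)
    rw [Nat.cast_one]
    exact coord_expG_mem_trigSum hX x i

theorem translate_zero {𝕜 : Type*} (X : lieAlg G) (f : orbit G v → 𝕜) : translate X 0 f = f := by
  ext x
  have h : act (expG X 0) x = x := by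
    refine Subtype.ext ?_
    change matAct _ _ = _
    rw [coe_expG, zero_smul, NormedSpace.exp_zero, matAct, Matrix.one_mulVec]
  rw [translate, h]

/-- The infinitesimal generator acts on `P_n(M)`, and there it is given by the Riesz formula. -/
theorem exists_generator_riesz {n : ℕ} (hn : 1 ≤ n) {X : lieAlg G}
    (hX : 1 / 2 * Matrix.trace ((X : Matrix (Fin N) (Fin N) ℝ) *
      (X : Matrix (Fin N) (Fin N) ℝ)ᵀ) = 1) (f : polySubmodule 𝕜 G v n) :
    ∃ g : polySubmodule 𝕜 G v n, GeneratorRel (translate X) (f : orbit G v → 𝕜) g ∧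
      RieszRel n (translate X) (f : orbit G v → 𝕜) g := by
  choose c hd hs using fun x => exists_riesz_of_mem_trigSum (Nat.cast_pos.mpr hn)
    (translate_apply_mem_trigSum hX f.2 x)
  have hgen : GeneratorRel (translate X) (f : orbit G v → 𝕜) c := by
    refine tendsto_pi_nhds.mpr fun x => ?_
    have h := hasDerivAt_iff_tendsto_slope_zero.mp (hd x)
    simpa [translate_zero] using h
  -- The pointwise limit of difference quotients stays in a finite-dimensional, hence closed,
  -- subspace.
  have hc : c ∈ polySubmodule 𝕜 G v n := by
    refine (Submodule.closed_of_finiteDimensional _).mem_of_tendsto hgen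
      (Eventually.of_forall fun t => ?_)
    rw [← algebraMap_smul 𝕜]
    exact Submodule.smul_mem _ _ (Submodule.sub_mem _ (translate_mem X t f.2) f.2)
  exact ⟨⟨c, hc⟩, hgen, Pi.hasSum.mpr hs⟩

/-! ### Transfer to other function spaces -/

section Transfer

theorem iterRel_foldr {ι W V : Type*} {A : ι → V → V → Prop} {Φ : W → V} {D : ι → W → W}
    (h : ∀ j w, A j (Φ w) (Φ (D j w))) (J : List ι) (w : W) :
    IterRel A J (Φ w) (Φ (J.foldr D w)) := by
  induction J with
  | nil => rfl
  | cons j J ih => exact ⟨_, ih, h j _⟩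

/-- The two signs match the form `-g` with `g = Φ (-∑ j, D j (D j w))`, shared by the Laplacian and
the Riesz sum. -/
theorem sumSqRel_sum {ι W V : Type*} [Fintype ι] [AddCommGroup W] [AddCommGroup V]
    {A : ι → V → V → Prop} {Φ : W →+ V} {D : ι → W → W} (h : ∀ j w, A j (Φ w) (Φ (D j w)))
    (w : W) : SumSqRel A (Φ w) (-Φ (-∑ j, D j (D j w))) :=
  ⟨fun j => Φ (D j (D j w)), fun j => iterRel_foldr h [j, j] w, by rw [map_neg, neg_neg, map_sum]⟩

variable {E V : Type*} [AddCommGroup E] [Module ℝ E] [TopologicalSpace E]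
  [AddCommGroup V] [Module ℝ V] [TopologicalSpace V] {W : Submodule ℝ E}
  {T : ℝ → E → E} {U : ℝ → V → V} {Φ : W →L[ℝ] V}

/-- The limit already holds in the invariant subspace `W`, and `Φ` is continuous and intertwines `T`
with `U`. -/
theorem GeneratorRel.map (hT : ∀ t, ∀ w ∈ W, T t w ∈ W)
    (hU : ∀ t (w : W), U t (Φ w) = Φ ⟨T t w, hT t w w.2⟩) {f g : W}
    (h : GeneratorRel T (f : E) g) : GeneratorRel U (Φ f) (Φ g) := by
  have h1 : Tendsto (fun t : ℝ => t⁻¹ • ((⟨T t f, hT t f f.2⟩ : W) - f)) (𝓝[≠] 0) (𝓝 g) :=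
    tendsto_subtype_rng.mpr h
  have h2 := (Φ.continuous.tendsto g).comp h1
  simpa [GeneratorRel, hU, Function.comp_def] using h2

theorem RieszRel.map (hT : ∀ t, ∀ w ∈ W, T t w ∈ W)
    (hU : ∀ t (w : W), U t (Φ w) = Φ ⟨T t w, hT t w w.2⟩) {r : ℝ} {f g : W}
    (h : RieszRel r T (f : E) g) : RieszRel r U (Φ f) (Φ g) := by
  have h1 : HasSum (fun k : ℤ =>
      (r / Real.pi ^ 2 * ((-1 : ℝ) ^ (k - 1) / ((k : ℝ) - 1 / 2) ^ 2)) •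
        (⟨T (Real.pi / r * ((k : ℝ) - 1 / 2)) f, hT _ f f.2⟩ : W)) g :=
    (Topology.IsInducing.hasSum_iff (g := W.subtype) Topology.IsInducing.subtypeVal _ _).mp h
  have h2 := Φ.hasSum h1
  simpa only [RieszRel, hU, map_smul] using h2

end Transfer

/-! ### Embedding into the `L_p` spaces -/

section LpTransfer

variable {n : ℕ} {μ : Measure (orbit G v)}

theorem norm_le_of_mem_orbit (x : orbit G v) : ‖x.1‖ ≤ ‖v‖ := by
  obtain ⟨g, -, hx⟩ := x.2
  have h : ‖matAct (g : Matrix (Fin N) (Fin N) ℝ) v‖ ^ 2 = ‖v‖ ^ 2 := by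
    have hg : (g : Matrix (Fin N) (Fin N) ℝ)ᵀ * g = 1 := by
      simpa using (Matrix.mem_orthogonalGroup_iff' (Fin N) ℝ).mp g.2
    rw [EuclideanSpace.real_norm_sq_eq, EuclideanSpace.real_norm_sq_eq]
    have h1 : (g.1 *ᵥ v.ofLp) ⬝ᵥ (g.1 *ᵥ v.ofLp) = v.ofLp ⬝ᵥ v.ofLp := by
      rw [Matrix.dotProduct_mulVec, ← Matrix.mulVec_transpose, Matrix.mulVec_mulVec, hg,
        Matrix.one_mulVec]
    simpa [dotProduct, matAct, sq] using h1
  rw [hx]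
  exact (pow_left_inj₀ (norm_nonneg _) (norm_nonneg _) two_ne_zero).mp h |>.le

/-- The orbit lies in a compact ball, so `f` is bounded, and `μ` is finite. -/
theorem memLp_of_mem_polySubmodule [IsFiniteMeasure μ] (p : ℝ≥0∞) {f : orbit G v → 𝕜}
    (hf : f ∈ polySubmodule 𝕜 G v n) : MemLp f p μ := by
  obtain ⟨P, -, hP⟩ := mem_polySubmodule.mp hf
  have hcont : Continuous fun x : EuclideanSpace ℝ (Fin N) =>
      P.eval (fun i => ((x i : ℝ) : 𝕜)) :=
    (MvPolynomial.continuous_eval P).comp (continuous_pi fun i =>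
      RCLike.continuous_ofReal.comp (by fun_prop))
  obtain ⟨C, hC⟩ := (isCompact_closedBall (0 : EuclideanSpace ℝ (Fin N)) ‖v‖)
    |>.exists_bound_of_continuousOn hcont.continuousOn
  have hfc : Continuous f := by
    rw [funext hP]
    exact hcont.comp continuous_subtype_val
  refine MemLp.of_bound hfc.aestronglyMeasurable C (Eventually.of_forall fun x => ?_)
  rw [hP]
  exact hC x (by simpa using norm_le_of_mem_orbit x)

/-- The embedding of `P_n(M)` into `L_p(M)`. -/
def polyToLp (𝕜 : Type*) [RCLike 𝕜] (n : ℕ) (μ : Measure (orbit G v)) [IsFiniteMeasure μ]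
    (p : ℝ≥0∞) [Fact (1 ≤ p)] :
    (polySubmodule 𝕜 G v n).restrictScalars ℝ →L[ℝ] Lp 𝕜 p μ :=
  let Φ : polySubmodule 𝕜 G v n →ₗ[𝕜] Lp 𝕜 p μ :=
    { toFun := fun f => (memLp_of_mem_polySubmodule p f.2).toLp f
      map_add' := fun _ _ => rfl
      map_smul' := fun _ _ => rfl }
  { toFun := fun f => (memLp_of_mem_polySubmodule (n := n) p f.2).toLp f
    map_add' := fun _ _ => rfl
    map_smul' := fun _ _ => rfl
    cont := Φ.continuous_of_finiteDimensional }

end LpTransfer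

end RieszFormula

end

theorem corollary2p2 {𝕜 : Type*} [RCLike 𝕜] {N d n : ℕ} (hn : 1 ≤ n)
    (G : Subgroup (Matrix.orthogonalGroup (Fin N) ℝ))
    (hG : IsClosed (G : Set (Matrix.orthogonalGroup (Fin N) ℝ)))
    (v : EuclideanSpace ℝ (Fin N)) (hv : ‖v‖ = 1)
    (X : Fin d → RieszFormula.lieAlg G) (hX : RieszFormula.IsOrthonormalBasis X)
    (f : RieszFormula.orbit G v → 𝕜) (hf : f ∈ RieszFormula.polySpace 𝕜 G v n)
    (μ : Measure (RieszFormula.orbit G v)) [IsFiniteMeasure μ]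
    (hμ : RieszFormula.InvariantMeasure μ) :
    -- `D_{j₁} ⋯ D_{j_k} f` and `R_{j₁} ⋯ R_{j_k} f` exist and are equal, pointwise on `M`
    -- and in every `L_p(M)`
    (∀ J : List (Fin d), ∃ g : RieszFormula.orbit G v → 𝕜,
      (RieszFormula.IterRel
          (fun j => RieszFormula.GeneratorRel (RieszFormula.translate (X j))) J f g ∧
        RieszFormula.IterRel
          (fun j => RieszFormula.RieszRel n (RieszFormula.translate (X j))) J f g) ∧
      ∀ (p : ℝ≥0∞) [Fact (1 ≤ p)], ∃ (hfp : MemLp f p μ) (hgp : MemLp g p μ),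
        RieszFormula.IterRel
          (fun j => RieszFormula.GeneratorRel (RieszFormula.translateLp hμ p (X j))) J
          (hfp.toLp f) (hgp.toLp g) ∧
        RieszFormula.IterRel
          (fun j => RieszFormula.RieszRel n (RieszFormula.translateLp hμ p (X j))) J
          (hfp.toLp f) (hgp.toLp g)) ∧
    -- `𝓛 f = - ∑ j, R_j R_j f`, pointwise on `M` and in every `L_p(M)`
    (∃ g : RieszFormula.orbit G v → 𝕜,
      (RieszFormula.LaplaceRel (fun j => RieszFormula.translate (X j)) f g ∧
        RieszFormula.SumSqRel
          (fun j => RieszFormula.RieszRel n (RieszFormula.translate (X j))) f (-g)) ∧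
      ∀ (p : ℝ≥0∞) [Fact (1 ≤ p)], ∃ (hfp : MemLp f p μ) (hgp : MemLp g p μ),
        RieszFormula.LaplaceRel (fun j => RieszFormula.translateLp hμ p (X j))
          (hfp.toLp f) (hgp.toLp g) ∧
        RieszFormula.SumSqRel
          (fun j => RieszFormula.RieszRel n (RieszFormula.translateLp hμ p (X j)))
          (hfp.toLp f) (-(hgp.toLp g))) := by
  have hn1 : ∀ j, 1 / 2 * Matrix.trace ((X j : Matrix (Fin N) (Fin N) ℝ) *
      (X j : Matrix (Fin N) (Fin N) ℝ)ᵀ) = 1 := fun j => by simpa using hX.1 j j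
  -- A single map `D j` of `P_n(M)` to itself represents both the generator and the Riesz operator,
  -- so all iterates agree.
  choose D hDg hDr using fun (j : Fin d) (w : RieszFormula.polySubmodule 𝕜 G v n) =>
    RieszFormula.exists_generator_riesz hn (hn1 j) w
  have hT : ∀ j t, ∀ w ∈ (RieszFormula.polySubmodule 𝕜 G v n).restrictScalars ℝ,
      RieszFormula.translate (X j) t w ∈ (RieszFormula.polySubmodule 𝕜 G v n).restrictScalars ℝ :=
    fun j t w hw => RieszFormula.translate_mem (X j) t hw
  have hLg : ∀ (p : ℝ≥0∞) [Fact (1 ≤ p)] j (w : RieszFormula.polySubmodule 𝕜 G v n),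
      RieszFormula.GeneratorRel (RieszFormula.translateLp hμ p (X j))
        (RieszFormula.polyToLp 𝕜 n μ p w) (RieszFormula.polyToLp 𝕜 n μ p (D j w)) :=
    fun p _ j w => RieszFormula.GeneratorRel.map (hT j) (fun _ _ => rfl) (hDg j w)
  have hLr : ∀ (p : ℝ≥0∞) [Fact (1 ≤ p)] j (w : RieszFormula.polySubmodule 𝕜 G v n),
      RieszFormula.RieszRel n (RieszFormula.translateLp hμ p (X j))
        (RieszFormula.polyToLp 𝕜 n μ p w) (RieszFormula.polyToLp 𝕜 n μ p (D j w)) :=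
    fun p _ j w => RieszFormula.RieszRel.map (hT j) (fun _ _ => rfl) (hDr j w)
  let F : RieszFormula.polySubmodule 𝕜 G v n := ⟨f, RieszFormula.mem_polySubmodule.mpr hf⟩
  have hLp : ∀ (p : ℝ≥0∞) (w : RieszFormula.polySubmodule 𝕜 G v n),
      MemLp (w : RieszFormula.orbit G v → 𝕜) p μ :=
    fun p w => RieszFormula.memLp_of_mem_polySubmodule p w.2
  refine ⟨fun J => ⟨(J.foldr D F).1, ⟨?_, ?_⟩, fun p _ =>
      ⟨hLp p F, hLp p (J.foldr D F), ?_, ?_⟩⟩,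
    ⟨(-∑ j, D j (D j F) : RieszFormula.polySubmodule 𝕜 G v n), ⟨?_, ?_⟩,
      fun p _ => ⟨hLp p F, hLp p _, ?_, ?_⟩⟩⟩
  · exact RieszFormula.iterRel_foldr (Φ := Subtype.val) hDg J F
  · exact RieszFormula.iterRel_foldr (Φ := Subtype.val) hDr J F
  · exact RieszFormula.iterRel_foldr (Φ := RieszFormula.polyToLp 𝕜 n μ p) (hLg p) J F
  · exact RieszFormula.iterRel_foldr (Φ := RieszFormula.polyToLp 𝕜 n μ p) (hLr p) J F
  · exact RieszFormula.sumSqRel_sum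
      (Φ := (RieszFormula.polySubmodule 𝕜 G v n).subtype.toAddMonoidHom) hDg F
  · exact RieszFormula.sumSqRel_sum
      (Φ := (RieszFormula.polySubmodule 𝕜 G v n).subtype.toAddMonoidHom) hDr F
  · exact RieszFormula.sumSqRel_sum
      (Φ := (RieszFormula.polyToLp 𝕜 n μ p).toLinearMap.toAddMonoidHom) (hLg p) F
  · exact RieszFormula.sumSqRel_sum
      (Φ := (RieszFormula.polyToLp 𝕜 n μ p).toLinearMap.toAddMonoidHom) (hLr p) F
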